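/- **Theorem 8.3 (Extended Model Completeness).** Formulas of Riesz modal logic are generated by $\phi ::= 0 \mid 1 \mid r\phi \mid \phi+\phi \mid \phi\sqcup\phi \mid \phi\sqcap\phi \mid \Diamond\phi$ with $r\in\mathbb{R}$; write $-\phi:=(-1)\phi$, $|\phi| := (\phi\sqcup 0)+(-\phi\sqcup 0)$, and let $\phi\le\psi$ stand for the equation $\phi\sqcap\psi=\phi$. *Proof system.* Write $\vdash\phi=\psi$ if $\phi=\psi$ is derivable in equational logic (reflexivity, symmetry, transitivity, congruence) from all instances of: the equational axioms of real vector spaces and of lattices; the compatibility axioms $(x\sqcap y)+z\le y+z$ and $r(x\sqcap y)\le ry$ for $r\ge 0$; $0\le 1$; and the modal axioms $\Diamond(r_1x+r_2y)=r_1\Diamond x+r_2\Diamond y$, $0\le\Diamond(x\sqcup 0)$, $\Diamond 1\le 1$; together with the infinitary Archimedean rule: from $n|x|\le|y|$ for all $n=1,2,3,\dots$ infer $x=0$. *Models.* A *Markov process* is a continuous map $\alpha:X\to\mathcal{R}^{\le1}(X)$, where $X$ is a compact Hausdorff space and $\mathcal{R}^{\le1}(X)$ is the set of Radon subprobability measures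 on $X$ with the weak-* topology (the coarsest making $\mu\mapsto\int_X f\,d\mu$ continuous for every $f\in C(X)$). A *measurable model* is a measurable map $\tau:X\to\mathcal{M}^{\le1}(X)$, where $X$ is a measurable space and $\mathcal{M}^{\le1}(X)$ is the set of subprobability measures on $X$ with the $\sigma$-algebra generated by the evaluations $\mu\mapsto\mu(S)$, $S\subseteq X$ measurable. In a model $\tau$ of either kind, $0$, $1$, $r\phi$, $+$, $\sqcup$, $\sqcap$ are interpreted pointwise (as the constants $0$ and $1$, scalar multiplication, sum, maximum, minimum) and $$[\![\Diamond\phi]\!]_\tau(x)=\int_X[\![\phi]\!]_\tau\,d\tau(x),$$ so that $[\![\phi]\!]_\tau$ is a continuous real function on $X$ if $\tau$ is a Markov process, and a bounded measurable real function on $X$ if $\tau$ is a measurable model. Let $\mathcal{C}$ be one of the following three classes: the measurable models whose state space is a standard Borel space; those whose state space is an analytic space (i.e. measurably isomorphic to an analytic subset of a Polish space); all measurable models. Then for any two formulas $\phi$ and $\psi$ the following are equivalent: 1. $\vdash\phi=\psi$; 2. $[\![\phi]\!]_\tau=[\![\psi]\!]_\tau$ holds for every Markov process $\tau$ and for every $\tau\in\mathcal{C}$.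 -/

import Mathlib

open MeasureTheory ProbabilityTheory

universe u

namespace RieszModal

/-- Formulas of Riesz modal logic:
`φ ::= 0 | 1 | r φ | φ + φ | φ ⊔ φ | φ ⊓ φ | ◇ φ` with `r ∈ ℝ`. Equivalently, the closed terms
in the signature of modal Riesz spaces. -/
inductive Form : Type
  | zero : Form
  | one : Form
  | smul : ℝ → Form → Form
  | add : Form → Form → Form
  | sup : Form → Form → Form
  | inf : Form → Form → Form
  | dia : Form → Form

namespace Form

/-! The following instances only provide notation for the constructors. -/

instance : Zero Form := ⟨Form.zero⟩
instance : One Form := ⟨Form.one⟩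
instance : SMul ℝ Form := ⟨Form.smul⟩
instance : Add Form := ⟨Form.add⟩
instance : Max Form := ⟨Form.sup⟩
instance : Min Form := ⟨Form.inf⟩

/-- `-φ` abbreviates `(-1) φ`. -/
instance : Neg Form := ⟨fun φ => (-1 : ℝ) • φ⟩

/-- `|φ|` abbreviates `φ⁺ + φ⁻`, where `φ⁺ = φ ⊔ 0` and `φ⁻ = -φ ⊔ 0`. -/
def abs (φ : Form) : Form := (φ ⊔ 0) + (-φ ⊔ 0)

end Form

open Form

/-- The (closed instances of the) equations of modal Riesz spaces.
An inequality `s ≤ t` stands for the equation `s ⊓ t = s`. -/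
inductive ModalRieszEq : Form → Form → Prop
  -- real vector spaces
  | add_assoc (x y z : Form) : ModalRieszEq (x + (y + z)) ((x + y) + z)
  | add_comm (x y : Form) : ModalRieszEq (x + y) (y + x)
  | add_zero (x : Form) : ModalRieszEq (x + 0) x
  | add_neg (x : Form) : ModalRieszEq (x + -x) 0
  | smul_smul (r s : ℝ) (x : Form) : ModalRieszEq (r • (s • x)) ((r * s) • x)
  | one_smul (x : Form) : ModalRieszEq ((1 : ℝ) • x) x
  | smul_add (r : ℝ) (x y : Form) : ModalRieszEq (r • (x + y)) (r • x + r • y)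
  | add_smul (r s : ℝ) (x : Form) : ModalRieszEq ((r + s) • x) (r • x + s • x)
  -- lattices
  | sup_assoc (x y z : Form) : ModalRieszEq (x ⊔ (y ⊔ z)) ((x ⊔ y) ⊔ z)
  | inf_assoc (x y z : Form) : ModalRieszEq (x ⊓ (y ⊓ z)) ((x ⊓ y) ⊓ z)
  | sup_comm (x y : Form) : ModalRieszEq (x ⊔ y) (y ⊔ x)
  | inf_comm (x y : Form) : ModalRieszEq (x ⊓ y) (y ⊓ x)
  | sup_inf_self (x y : Form) : ModalRieszEq (x ⊔ (x ⊓ y)) x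
  | inf_sup_self (x y : Form) : ModalRieszEq (x ⊓ (x ⊔ y)) x
  | sup_idem (x : Form) : ModalRieszEq (x ⊔ x) x
  | inf_idem (x : Form) : ModalRieszEq (x ⊓ x) x
  -- compatibility: `(x ⊓ y) + z ≤ y + z`, and `r (x ⊓ y) ≤ r y` for `r ≥ 0`
  | add_compat (x y z : Form) :
      ModalRieszEq (((x ⊓ y) + z) ⊓ (y + z)) ((x ⊓ y) + z)
  | smul_compat (r : ℝ) (hr : 0 ≤ r) (x y : Form) :
      ModalRieszEq ((r • (x ⊓ y)) ⊓ (r • y)) (r • (x ⊓ y))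
  -- positive element: `0 ≤ 1`
  | zero_le_one : ModalRieszEq (0 ⊓ 1) 0
  -- modality: linearity, positivity `0 ≤ ◇ (x ⊔ 0)`, and `◇ 1 ≤ 1`
  | dia_linear (r s : ℝ) (x y : Form) :
      ModalRieszEq (dia (r • x + s • y)) (r • dia x + s • dia y)
  | dia_pos (x : Form) : ModalRieszEq (0 ⊓ dia (x ⊔ 0)) 0
  | dia_one_le : ModalRieszEq (dia 1 ⊓ 1) (dia 1)

/-- `Provable φ ψ`: the equation `φ = ψ` is derivable from the equations of modal Riesz spaces
by equational logic together with the (infinitary) Archimedean rule: from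
`n |x| ≤ |y|` for all `n = 1, 2, 3, …` infer `x = 0`. -/
inductive Provable : Form → Form → Prop
  | base {x y : Form} : ModalRieszEq x y → Provable x y
  | refl (x : Form) : Provable x x
  | symm {x y : Form} : Provable x y → Provable y x
  | trans {x y z : Form} : Provable x y → Provable y z → Provable x z
  | congr_smul (r : ℝ) {x y : Form} : Provable x y → Provable (r • x) (r • y)
  | congr_add {x x' y y' : Form} : Provable x x' → Provable y y' → Provable (x + y) (x' + y')
  | congr_sup {x x' y y' : Form} : Provable x x' → Provable y y' → Provable (x ⊔ y) (x' ⊔ y')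
  | congr_inf {x x' y y' : Form} : Provable x x' → Provable y y' → Provable (x ⊓ y) (x' ⊓ y')
  | congr_dia {x y : Form} : Provable x y → Provable (dia x) (dia y)
  | archimedean {x y : Form} :
      (∀ n : ℕ, 1 ≤ n → Provable (((n : ℝ) • x.abs) ⊓ y.abs) ((n : ℝ) • x.abs)) →
      Provable x 0

/-! ### Markov processes on compact Hausdorff spaces -/

/-- Radon subprobability measures on `X` (`X` carries its Borel `σ`-algebra). -/
structure RadonSubprob (X : Type u) [TopologicalSpace X] [MeasurableSpace X] where
  toMeasure : Measure X
  mass_le_one : toMeasure Set.univ ≤ 1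
  /-- The measure of every Borel set is the supremum of the measures of its compact subsets. -/
  innerRegular : toMeasure.InnerRegular

/-- The weak-* topology: the coarsest one that makes `μ ↦ ∫ f dμ` continuous for all `f ∈ C(X)`. -/
noncomputable instance (X : Type u) [TopologicalSpace X] [MeasurableSpace X] :
    TopologicalSpace (RadonSubprob X) :=
  ⨅ f : C(X, ℝ), TopologicalSpace.induced
    (fun μ : RadonSubprob X => ∫ x, f x ∂μ.toMeasure) inferInstance

theorem RadonSubprob.continuous_integral {X : Type u} [TopologicalSpace X] [MeasurableSpace X]
    (f : C(X, ℝ)) : Continuous fun μ : RadonSubprob X => ∫ x, f x ∂μ.toMeasure :=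
  continuous_iff_le_induced.2 (iInf_le _ f)

section Topological

variable {X : Type u} [TopologicalSpace X] [MeasurableSpace X]

/-- The operator `◇_α` on `C(X)`: `◇_α f (x) = ∫ f dα(x)`. -/
noncomputable def diaC (α : C(X, RadonSubprob X)) (f : C(X, ℝ)) : C(X, ℝ) where
  toFun x := ∫ y, f y ∂(α x).toMeasure
  continuous_toFun := (RadonSubprob.continuous_integral f).comp α.continuous

/-- The semantics of a formula in a Markov process `α : X → R^{≤ 1}(X)` (a continuous map into
the space of Radon subprobability measures) is an element of `C(X)`. -/
noncomputable def semC (α : C(X, RadonSubprob X)) : Form → C(X, ℝ)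
  | .zero => 0
  | .one => 1
  | .smul r φ => r • semC α φ
  | .add φ ψ => semC α φ + semC α ψ
  | .sup φ ψ => semC α φ ⊔ semC α ψ
  | .inf φ ψ => semC α φ ⊓ semC α ψ
  | .dia φ => diaC α (semC α φ)

end Topological

/-! ### Markov kernels on measurable spaces -/

/-- A measurable map `τ : X → M^{≤ 1}(X)` into the subprobability measures on `X`, the latter
carrying the `σ`-algebra generated by the evaluations at measurable sets. -/
structure SubMarkovKernel (X : Type u) [MeasurableSpace X] where
  toKernel : Kernel X X
  mass_le_one : ∀ x, toKernel x Set.univ ≤ 1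

/-- Bounded measurable real-valued functions. -/
def BddMeas (X : Type u) [MeasurableSpace X] : Type u :=
  {f : X → ℝ // Measurable f ∧ ∃ C : ℝ, ∀ x, |f x| ≤ C}

section Measurable

variable {X : Type u} [MeasurableSpace X]

/-- The operator `◇_τ` on bounded measurable functions: `◇_τ f (x) = ∫ f dτ(x)`. -/
noncomputable def diaM (τ : SubMarkovKernel X) (f : BddMeas X) : BddMeas X :=
  ⟨fun x => ∫ y, f.1 y ∂(τ.toKernel x), by
    obtain ⟨f, hf, C, hC⟩ := f
    have : IsFiniteKernel τ.toKernel := ⟨⟨1, ENNReal.one_lt_top, τ.mass_le_one⟩⟩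
    refine ⟨(hf.stronglyMeasurable.integral_kernel).measurable, |C|, fun x => ?_⟩
    have h1 : (τ.toKernel x).real Set.univ ≤ 1 :=
      ENNReal.toReal_le_of_le_ofReal zero_le_one (by simpa using τ.mass_le_one x)
    calc |∫ y, f y ∂(τ.toKernel x)|
        = ‖∫ y, f y ∂(τ.toKernel x)‖ := (Real.norm_eq_abs _).symm
      _ ≤ |C| * (τ.toKernel x).real Set.univ :=
          norm_integral_le_of_norm_le_const
            (Filter.Eventually.of_forall fun y => (hC y).trans (le_abs_self C))
      _ ≤ |C| := mul_le_of_le_one_right (abs_nonneg C) h1⟩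

/-- The semantics of a formula in a model `τ : X → M^{≤ 1}(X)` is a bounded measurable function;
all connectives but `◇` are interpreted pointwise. -/
noncomputable def semM (τ : SubMarkovKernel X) : Form → BddMeas X
  | .zero => ⟨fun _ => 0, measurable_const, 0, by simp⟩
  | .one => ⟨fun _ => 1, measurable_const, 1, by simp⟩
  | .smul r φ => ⟨fun x => r * (semM τ φ).1 x, (semM τ φ).2.1.const_mul r, by
      obtain ⟨C, hC⟩ := (semM τ φ).2.2
      exact ⟨|r| * C, fun x => by
        rw [abs_mul]; exact mul_le_mul_of_nonneg_left (hC x) (abs_nonneg r)⟩⟩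
  | .add φ ψ => ⟨fun x => (semM τ φ).1 x + (semM τ ψ).1 x,
      (semM τ φ).2.1.add (semM τ ψ).2.1, by
      obtain ⟨C, hC⟩ := (semM τ φ).2.2
      obtain ⟨D, hD⟩ := (semM τ ψ).2.2
      exact ⟨C + D, fun x => (abs_add_le _ _).trans (add_le_add (hC x) (hD x))⟩⟩
  | .sup φ ψ => ⟨fun x => max ((semM τ φ).1 x) ((semM τ ψ).1 x),
      (semM τ φ).2.1.max (semM τ ψ).2.1, by
      obtain ⟨C, hC⟩ := (semM τ φ).2.2
      obtain ⟨D, hD⟩ := (semM τ ψ).2.2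
      exact ⟨max C D, fun x => abs_max_le_max_abs_abs.trans (max_le_max (hC x) (hD x))⟩⟩
  | .inf φ ψ => ⟨fun x => min ((semM τ φ).1 x) ((semM τ ψ).1 x),
      (semM τ φ).2.1.min (semM τ ψ).2.1, by
      obtain ⟨C, hC⟩ := (semM τ φ).2.2
      obtain ⟨D, hD⟩ := (semM τ ψ).2.2
      exact ⟨max C D, fun x => abs_min_le_max_abs_abs.trans (max_le_max (hC x) (hD x))⟩⟩
  | .dia φ => diaM τ (semM τ φ)

end Measurable

/-- A measurable space is analytic if it is measurably isomorphic to an analytic subset of a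
Polish space (with its Borel `σ`-algebra). -/
def IsAnalyticSpace (X : Type u) [MeasurableSpace X] : Prop :=
  ∃ (P : Type u) (_ : TopologicalSpace P) (_ : PolishSpace P) (_ : MeasurableSpace P)
    (_ : BorelSpace P) (A : Set P), AnalyticSet A ∧ Nonempty (X ≃ᵐ A)

/-- The three classes of measure-theoretic models, according to their state spaces. -/
inductive ModelClass
  | standardBorel
  | analytic
  | measurable

/-- `c.Admits X`: the measurable space `X` is a state space of models in the class `c`. -/
def ModelClass.Admits (c : ModelClass) (X : Type u) [MeasurableSpace X] : Prop :=
  match c with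
  | .standardBorel => StandardBorelSpace X
  | .analytic => IsAnalyticSpace X
  | .measurable => True

end RieszModal

/-! Soundness holds because formulas are evaluated pointwise in the Archimedean Riesz space of reals
and integration against a subprobability measure is linear, positive and at most 1 on the constant
1. One argument, `IsPointwiseSem.provable`, covers both kinds of model.

Completeness needs only Markov processes, in fact a single one. Formulas modulo provable equality
form an Archimedean Riesz space with strong unit 1 and a positive operator induced by ◇. By Yosida's
argument (`exists_isRealHom_ne_zero`) its unital real-valued homomorphisms separate points. They
form a compact Hausdorff space X, and evaluation embeds the algebra in C(X) with dense image. For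
each state x, the functional a ↦ (◇a)(x) is positive on that image. It extends to C(X) by M. Riesz
and is integration against a Radon measure by Riesz–Markov–Kakutani; density makes the measure
depend continuously on x (`exists_markov_of_positive`). In this process every formula denotes its
own class, so semantic equality there already gives provability. -/

namespace RieszModal

/-! ### Real-valued homomorphisms of Archimedean Riesz spaces with a strong unit -/

section Yosida

variable {A : Type*} [AddCommGroup A] [Lattice A]

/-- The positive cone of a proper order ideal: an ideal not containing `e`. -/
structure IsProperCone (e : A) (J : Set A) : Prop where
  nonneg : ∀ x ∈ J, 0 ≤ x
  zero_mem : 0 ∈ J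
  add_mem : ∀ x ∈ J, ∀ y ∈ J, x + y ∈ J
  lower : ∀ x y, 0 ≤ x → x ≤ y → y ∈ J → x ∈ J
  unit_notMem : e ∉ J

namespace IsProperCone

variable {e : A} {J : Set A}

theorem nsmul_mem (hJ : IsProperCone e J) {x : A} (hx : x ∈ J) (n : ℕ) : n • x ∈ J := by
  induction n with
  | zero => simpa using hJ.zero_mem
  | succ n ih => rw [succ_nsmul]; exact hJ.add_mem _ ih _ hx

theorem exists_maximal (hJ : IsProperCone e J) :
    ∃ M, J ⊆ M ∧ Maximal (IsProperCone e) M := by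
  refine zorn_subset_nonempty {J | IsProperCone e J} (fun c hc hchain hne => ?_) J hJ
  refine ⟨⋃₀ c, ⟨?_, ?_, ?_, ?_, ?_⟩, fun s hs => Set.subset_sUnion_of_mem hs⟩
  · rintro x ⟨s, hs, hx⟩
    exact (hc hs).nonneg x hx
  · obtain ⟨s, hs⟩ := hne
    exact ⟨s, hs, (hc hs).zero_mem⟩
  · rintro x ⟨s, hs, hx⟩ y ⟨t, ht, hy⟩
    rcases hchain.total hs ht with h | h
    · exact ⟨t, ht, (hc ht).add_mem x (h hx) y hy⟩
    · exact ⟨s, hs, (hc hs).add_mem x hx y (h hy)⟩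
  · rintro x y hx hxy ⟨s, hs, hy⟩
    exact ⟨s, hs, (show IsProperCone e s from hc hs).lower x y hx hxy hy⟩
  · rintro ⟨s, hs, he⟩
    exact (hc hs).unit_notMem he

end IsProperCone

/-! ### Disjoint elements and primeness of maximal ideals -/

variable [IsOrderedAddMonoid A]

theorem inf_add_le {x y z : A} (hx : 0 ≤ x) (hy : 0 ≤ y) (hz : 0 ≤ z) :
    x ⊓ (y + z) ≤ x ⊓ y + x ⊓ z := by
  rw [inf_add, add_inf, add_inf]
  refine le_inf (le_inf ?_ ?_) (le_inf ?_ inf_le_right)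
  · exact inf_le_left.trans (le_add_of_nonneg_left hx)
  · exact inf_le_left.trans (le_add_of_nonneg_right hz)
  · exact inf_le_left.trans (le_add_of_nonneg_left hy)

theorem inf_nsmul_eq_zero {x y : A} (hx : 0 ≤ x) (hy : 0 ≤ y) (h : x ⊓ y = 0) (n : ℕ) :
    x ⊓ n • y = 0 := by
  induction n with
  | zero => simpa using hx
  | succ n ih =>
    refine le_antisymm ?_ (le_inf hx (nsmul_nonneg hy _))
    rw [succ_nsmul]
    exact (inf_add_le hx (nsmul_nonneg hy n) hy).trans (by rw [ih, h, add_zero])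

theorem nsmul_inf_nsmul_eq_zero {x y : A} (hx : 0 ≤ x) (hy : 0 ≤ y) (h : x ⊓ y = 0) (m n : ℕ) :
    m • x ⊓ n • y = 0 := by
  refine inf_nsmul_eq_zero (nsmul_nonneg hx m) hy ?_ n
  rw [inf_comm] at h ⊢
  exact inf_nsmul_eq_zero hy hx h m

namespace IsProperCone

variable {e : A} {J : Set A}

/-- The cone generated by `J` and `a` is strictly larger than `J`, so by maximality it can fail to
be proper only by containing `e`. -/
theorem exists_unit_le_of_maximal (hJ : Maximal (IsProperCone e) J) {a : A} (ha : 0 ≤ a)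
    (haJ : a ∉ J) : ∃ j ∈ J, ∃ n : ℕ, e ≤ j + n • a := by
  by_contra! hcon
  have hK : IsProperCone e {x | 0 ≤ x ∧ ∃ j ∈ J, ∃ n : ℕ, x ≤ j + n • a} := by
    refine ⟨fun x hx => hx.1, ⟨le_rfl, 0, hJ.prop.zero_mem, 0, by simp⟩, ?_, ?_, ?_⟩
    · rintro x ⟨hx, j, hj, n, hn⟩ y ⟨hy, k, hk, m, hm⟩
      refine ⟨add_nonneg hx hy, j + k, hJ.prop.add_mem j hj k hk, n + m, ?_⟩
      calc x + y ≤ (j + n • a) + (k + m • a) := add_le_add hn hm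
        _ = _ := by rw [add_nsmul]; abel
    · rintro x y hx hxy ⟨-, j, hj, n, hn⟩
      exact ⟨hx, j, hj, n, hxy.trans hn⟩
    · rintro ⟨-, j, hj, n, hn⟩
      exact hcon j hj n hn
  have hsub : J ⊆ {x | 0 ≤ x ∧ ∃ j ∈ J, ∃ n : ℕ, x ≤ j + n • a} :=
    fun x hx => ⟨hJ.prop.nonneg x hx, x, hx, 0, by simp⟩
  exact haJ (hJ.le_of_ge hK hsub ⟨ha, 0, hJ.prop.zero_mem, 1, by simp⟩)

/-- Maximal ideals are prime. Otherwise `e` lies below both `j + k + n • a` and `j + k + m • b`;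
multiples of disjoint elements are disjoint, so their meet is `j + k`, which forces `e` into `J`. -/
theorem mem_or_mem_of_maximal (he : 0 ≤ e) (hJ : Maximal (IsProperCone e) J) {a b : A}
    (ha : 0 ≤ a) (hb : 0 ≤ b) (hab : a ⊓ b = 0) : a ∈ J ∨ b ∈ J := by
  by_contra! hcon
  obtain ⟨j, hj, n, hn⟩ := exists_unit_le_of_maximal hJ ha hcon.1
  obtain ⟨k, hk, m, hm⟩ := exists_unit_le_of_maximal hJ hb hcon.2
  have hj0 := hJ.prop.nonneg j hj
  have hk0 := hJ.prop.nonneg k hk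
  refine hJ.prop.unit_notMem (hJ.prop.lower e (j + k) he ?_ (hJ.prop.add_mem j hj k hk))
  calc e ≤ (j + k + n • a) ⊓ (j + k + m • b) := by
        refine le_inf (hn.trans ?_) (hm.trans ?_)
        · gcongr; exact le_add_of_nonneg_right hk0
        · gcongr; exact le_add_of_nonneg_left hj0
    _ = j + k := by rw [← add_inf, nsmul_inf_nsmul_eq_zero ha hb hab, add_zero]

variable [Module ℝ A]

theorem posPart_smul_mem [PosSMulMono ℝ A] (hJ : IsProperCone e J) {x : A} (hx : x⁺ ∈ J) {r : ℝ} (hr : 0 ≤ r) :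
    (r • x)⁺ ∈ J := by
  -- Cones are closed under natural multiples and under passing to smaller positive elements, so `r`
  -- is rounded up.
  obtain ⟨n, hn⟩ := exists_nat_ge r
  refine hJ.lower _ (n • x⁺) (posPart_nonneg _) (sup_le ?_ (nsmul_nonneg (posPart_nonneg _) n))
    (hJ.nsmul_mem hx n)
  calc r • x ≤ r • x⁺ := smul_le_smul_of_nonneg_left (le_posPart x) hr
    _ ≤ r • x⁺ + ((n : ℝ) - r) • x⁺ :=
      le_add_of_nonneg_right (smul_nonneg (sub_nonneg.2 hn) (posPart_nonneg x))
    _ = n • x⁺ := by rw [← add_smul, add_sub_cancel, Nat.cast_smul_eq_nsmul]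

/-- The reals which bound `x` from above modulo the ideal generated by `J`. -/
def upper (e : A) (J : Set A) (x : A) : Set ℝ := {r | (x - r • e)⁺ ∈ J}

theorem upper_add (hJ : IsProperCone e J) {x y : A} {r s : ℝ} (hr : r ∈ upper e J x)
    (hs : s ∈ upper e J y) : r + s ∈ upper e J (x + y) := by
  refine hJ.lower _ _ (posPart_nonneg _) (sup_le ?_ ?_) (hJ.add_mem _ hr _ hs)
  · calc x + y - (r + s) • e = (x - r • e) + (y - s • e) := by rw [add_smul]; abel
      _ ≤ _ := add_le_add (le_posPart _) (le_posPart _)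
  · exact add_nonneg (posPart_nonneg _) (posPart_nonneg _)

theorem upper_anti (hJ : IsProperCone e J) {x y : A} (hxy : x ≤ y) {r : ℝ}
    (hr : r ∈ upper e J y) : r ∈ upper e J x :=
  hJ.lower _ _ (posPart_nonneg _) (posPart_mono (sub_le_sub_right hxy _)) hr

theorem upper_mono [PosSMulMono ℝ A] (he : 0 ≤ e) (hJ : IsProperCone e J) {x : A} {r s : ℝ} (hrs : r ≤ s)
    (hr : r ∈ upper e J x) : s ∈ upper e J x :=
  hJ.lower _ _ (posPart_nonneg _)
    (posPart_mono (sub_le_sub_left (by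
      rw [← sub_nonneg, ← sub_smul]; exact smul_nonneg (sub_nonneg.2 hrs) he) _)) hr

theorem upper_sup (hJ : IsProperCone e J) {x y : A} {r : ℝ} (hx : r ∈ upper e J x)
    (hy : r ∈ upper e J y) : r ∈ upper e J (x ⊔ y) := by
  refine hJ.lower _ _ (posPart_nonneg _) (sup_le ?_ ?_) (hJ.add_mem _ hx _ hy)
  · rw [sup_sub]
    exact sup_le ((le_posPart _).trans (le_add_of_nonneg_right (posPart_nonneg _)))
      ((le_posPart _).trans (le_add_of_nonneg_left (posPart_nonneg _)))
  · exact add_nonneg (posPart_nonneg _) (posPart_nonneg _)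

theorem upper_smul [PosSMulMono ℝ A] (hJ : IsProperCone e J) {x : A} {r s : ℝ} (hr : 0 ≤ r)
    (hs : s ∈ upper e J x) : r * s ∈ upper e J (r • x) := by
  have := hJ.posPart_smul_mem hs hr
  rwa [smul_sub, smul_smul] at this

theorem nonneg_of_mem_upper_zero [PosSMulMono ℝ A] (he : 0 ≤ e) (hJ : IsProperCone e J) {r : ℝ}
    (hr : r ∈ upper e J (0 : A)) : 0 ≤ r := by
  by_contra! h
  have h1 : (-r)⁻¹ * r ∈ upper e J ((-r)⁻¹ • (0 : A)) :=
    hJ.upper_smul (inv_nonneg.2 (by linarith)) hr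
  have h2 : (-r)⁻¹ * r = -1 := by rw [inv_neg, neg_mul, inv_mul_cancel₀ h.ne]
  rw [h2, smul_zero] at h1
  have h3 : (0 - (-1 : ℝ) • e)⁺ = e := by simpa using he
  exact hJ.unit_notMem (h3 ▸ h1)

/-- The positive and negative parts of `x - r • e` are disjoint, so primeness puts one of them in
`J`: modulo `J`, every element is comparable with every multiple of `e`. -/
theorem mem_upper_or_neg_mem_upper (he : 0 ≤ e) (hJ : Maximal (IsProperCone e) J) (x : A)
    (r : ℝ) : r ∈ upper e J x ∨ -r ∈ upper e J (-x) := by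
  have h := mem_or_mem_of_maximal he hJ (posPart_nonneg (x - r • e)) (negPart_nonneg _)
    (posPart_inf_negPart_eq_zero _)
  rwa [← posPart_neg, show -(x - r • e) = -x - (-r) • e by rw [neg_smul]; abel] at h

end IsProperCone

/-! ### Real-valued homomorphisms from maximal ideals -/

variable [Module ℝ A]

/-- The real-valued Riesz homomorphisms on `A` mapping `e` to `1`. -/
structure IsRealHom (e : A) (h : A → ℝ) : Prop where
  map_add : ∀ x y, h (x + y) = h x + h y
  map_smul : ∀ (r : ℝ) x, h (r • x) = r * h x
  map_sup : ∀ x y, h (x ⊔ y) = h x ⊔ h y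
  map_unit : h e = 1

open IsProperCone in
-- The value of `x` is its least upper bound by multiples of `e` modulo `J`. Closure properties of
-- `upper` give only inequalities; the identity `h (-x) = -h x`, which rests on primeness, turns
-- those for sums and scalars into equalities.
theorem isRealHom_sInf_upper [PosSMulMono ℝ A] {e : A} (he : 0 ≤ e) (hunit : ∀ x : A, ∃ n : ℕ, x ≤ (n : ℝ) • e)
    {J : Set A} (hJ : Maximal (IsProperCone e) J) :
    IsRealHom e (fun x => sInf (upper e J x)) ∧
      ∀ x, ∀ r ∈ upper e J x, sInf (upper e J x) ≤ r := by
  have hne : ∀ x, (upper e J x).Nonempty := fun x => by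
    obtain ⟨n, hn⟩ := hunit x
    refine ⟨n, ?_⟩
    have : (x - (n : ℝ) • e)⁺ = 0 := posPart_eq_zero.2 (sub_nonpos.2 hn)
    simpa [upper, this] using hJ.prop.zero_mem
  have hbdd : ∀ x, BddBelow (upper e J x) := fun x => by
    obtain ⟨s, hs⟩ := hne (-x)
    refine ⟨-s, fun r hr => ?_⟩
    have h := upper_add hJ.prop hr hs
    rw [add_neg_cancel] at h
    linarith [nonneg_of_mem_upper_zero he hJ.prop h]
  set h : A → ℝ := fun x => sInf (upper e J x) with hdef
  have hle : ∀ x, ∀ r ∈ upper e J x, h x ≤ r := fun x r hr => csInf_le (hbdd x) hr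
  have hmem : ∀ x r, h x < r → r ∈ upper e J x := fun x r hr => by
    obtain ⟨s, hs, hsr⟩ := exists_lt_of_csInf_lt (hne x) hr
    exact upper_mono he hJ.prop hsr.le hs
  have h0 : 0 ≤ h 0 := le_csInf (hne 0) fun r hr => nonneg_of_mem_upper_zero he hJ.prop hr
  have hadd : ∀ x y, h (x + y) ≤ h x + h y := fun x y => by
    refine le_of_forall_pos_le_add fun ε hε => ?_
    have := hle _ _ (upper_add hJ.prop (hmem x (h x + ε / 2) (by linarith))
      (hmem y (h y + ε / 2) (by linarith)))
    linarith
  have hneg : ∀ x, h (-x) = -h x := fun x => by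
    apply le_antisymm
    -- A real `s` below `h x` is not an upper bound of `x`, so `-s` is one of `-x`.
    · have : h x ≤ -h (-x) := le_of_forall_lt fun r hr => by
        obtain ⟨s, hrs, hs⟩ := exists_between hr
        rcases mem_upper_or_neg_mem_upper he hJ x s with h1 | h1
        · linarith [hle _ _ h1]
        · linarith [hle _ _ h1]
      linarith
    · have := hadd x (-x)
      rw [add_neg_cancel] at this
      linarith
  have hadd' : ∀ x y, h (x + y) = h x + h y := fun x y => by
    refine le_antisymm (hadd x y) ?_
    have := hadd (x + y) (-y)
    rw [add_neg_cancel_right, hneg] at this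
    linarith
  have hmul : ∀ r : ℝ, 0 < r → ∀ x, h (r • x) ≤ r * h x := fun r hr x => by
    rw [← div_le_iff₀' hr]
    refine le_csInf (hne x) fun s hs => ?_
    rw [div_le_iff₀' hr]
    exact hle _ _ (upper_smul hJ.prop hr.le hs)
  have hmul' : ∀ r : ℝ, 0 < r → ∀ x, h (r • x) = r * h x := fun r hr x => by
    refine le_antisymm (hmul r hr x) ?_
    have := hmul r hr (-x)
    rw [smul_neg, hneg, hneg] at this
    linarith
  have hmono : ∀ x y, x ≤ y → h x ≤ h y := fun x y hxy =>
    le_csInf (hne y) fun r hr => hle _ _ (upper_anti hJ.prop hxy hr)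
  refine ⟨⟨hadd', fun r x => ?_, fun x y => ?_, ?_⟩, hle⟩
  · rcases lt_trichotomy r 0 with hr | rfl | hr
    · have := hmul' (-r) (by linarith) x
      rw [neg_smul, hneg] at this
      linarith
    · have := hadd' 0 0
      rw [add_zero] at this
      rw [zero_smul, zero_mul]
      linarith
    · exact hmul' r hr x
  · refine le_antisymm (le_of_forall_gt fun r hr => ?_)
      (sup_le (hmono _ _ le_sup_left) (hmono _ _ le_sup_right))
    obtain ⟨s, hs, hsr⟩ := exists_between hr
    exact (hle _ _ (upper_sup hJ.prop (hmem x s (le_sup_left.trans_lt hs))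
      (hmem y s (le_sup_right.trans_lt hs)))).trans_lt hsr
  · apply le_antisymm
    · exact hle _ _ (by simpa [upper] using hJ.prop.zero_mem)
    · have : h (-e) ≤ -1 := hle _ _ (by simpa [upper] using hJ.prop.zero_mem)
      rw [hneg] at this
      linarith

/-- If `e` were below a multiple of `(a - e)⁻`, it would be disjoint from `(a - e)⁺`. The latter is
below a multiple of the strong unit `e`, hence would vanish. A homomorphism killing this cone gives
`a` a value of at least 1. -/
theorem isProperCone_of_not_le {e a : A} (he : 0 ≤ e) (hunit : ∀ x : A, ∃ n : ℕ, x ≤ (n : ℝ) • e)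
    (h : ¬ a ≤ e) : IsProperCone e {x | 0 ≤ x ∧ ∃ n : ℕ, x ≤ n • (a - e)⁻} := by
  refine ⟨fun x hx => hx.1, ⟨le_rfl, 0, by simp⟩, ?_, ?_, ?_⟩
  · rintro x ⟨hx, n, hn⟩ y ⟨hy, m, hm⟩
    exact ⟨add_nonneg hx hy, n + m, by rw [add_nsmul]; exact add_le_add hn hm⟩
  · rintro x y hx hxy ⟨-, n, hn⟩
    exact ⟨hx, n, hxy.trans hn⟩
  · rintro ⟨-, k, hk⟩
    obtain ⟨m, hm⟩ := hunit (a - e)⁺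
    have h1 : (a - e)⁺ ⊓ e = 0 := by
      refine le_antisymm ?_ (le_inf (posPart_nonneg _) he)
      exact (inf_le_inf_left _ hk).trans
        (inf_nsmul_eq_zero (posPart_nonneg _) (negPart_nonneg _)
          (posPart_inf_negPart_eq_zero _) k).le
    have h2 := inf_nsmul_eq_zero (posPart_nonneg _) he h1 m
    rw [Nat.cast_smul_eq_nsmul] at hm
    rw [inf_eq_left.2 hm, posPart_eq_zero, sub_nonpos] at h2
    exact h h2

/-- The real-valued homomorphisms of an Archimedean Riesz space with a strong unit separate its
points. -/
theorem exists_isRealHom_ne_zero [PosSMulMono ℝ A] {e : A} (he : 0 ≤ e)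
    (hunit : ∀ x : A, ∃ n : ℕ, x ≤ (n : ℝ) • e)
    (harch : ∀ x y : A, 0 ≤ x → (∀ n : ℕ, n • x ≤ y) → x = 0) {a : A} (ha : a ≠ 0) :
    ∃ h, IsRealHom e h ∧ h a ≠ 0 := by
  have ha' : |a| ≠ 0 := fun h => ha <|
    le_antisymm (h ▸ le_abs_self a) (neg_nonpos.1 (h ▸ neg_le_abs a))
  obtain ⟨n, hn⟩ : ∃ n : ℕ, ¬ n • |a| ≤ e := by
    by_contra! hcon
    exact ha' (harch |a| e (abs_nonneg a) hcon)
  obtain ⟨J, hsub, hJ⟩ := (isProperCone_of_not_le he hunit hn).exists_maximal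
  obtain ⟨hh, hle⟩ := isRealHom_sInf_upper he hunit hJ
  refine ⟨_, hh, fun h0 => ?_⟩
  -- Since `(e - n • |a|)⁺ = (n • |a| - e)⁻` lies in `J`, the value of `n • |a|` is at least 1,
  -- which excludes `h a = 0`.
  have hmem : (-1 : ℝ) ∈ IsProperCone.upper e J (-(n • |a|)) := by
    have : (n • |a| - e)⁻ ∈ J := hsub ⟨negPart_nonneg _, 1, by simp⟩
    rw [← posPart_neg] at this
    simpa [IsProperCone.upper, neg_add_eq_sub] using this
  have h1 := hle _ _ hmem
  have h2 : -(n • |a|) = (-(n : ℝ)) • (a ⊔ ((-1 : ℝ) • a)) := by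
    rw [neg_smul, Nat.cast_smul_eq_nsmul, neg_one_smul]; rfl
  have h3 := hh.map_smul (-(n : ℝ)) (a ⊔ ((-1 : ℝ) • a))
  rw [← h2, hh.map_sup, hh.map_smul] at h3
  rw [h3, show sInf (IsProperCone.upper e J a) = 0 from h0] at h1
  norm_num at h1

end Yosida

/-! ### Markov processes from positive operators -/

section MarkovConstruction

/-- Riesz–Markov–Kakutani: compactness makes every continuous function compactly supported, and the
total mass is `g 1`. -/
theorem exists_radonSubprob_of_positive {X : Type u} [TopologicalSpace X] [CompactSpace X]
    [T2Space X] [MeasurableSpace X] [BorelSpace X] (g : C(X, ℝ) →ₗ[ℝ] ℝ)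
    (hg : ∀ f, 0 ≤ f → 0 ≤ g f) (hg1 : g 1 ≤ 1) :
    ∃ μ : RadonSubprob X, ∀ f : C(X, ℝ), ∫ x, f x ∂μ.toMeasure = g f := by
  let Λ : CompactlySupportedContinuousMap X ℝ →ₚ[ℝ] ℝ := PositiveLinearMap.mk₀
    { toFun := fun f => g f.toContinuousMap
      map_add' := fun f f' => g.map_add f.toContinuousMap f'.toContinuousMap
      map_smul' := fun r f => g.map_smul r f.toContinuousMap }
    (fun f hf => hg _ hf)
  have hint : ∀ f : C(X, ℝ), ∫ x, f x ∂(RealRMK.rieszMeasure Λ) = g f := fun f =>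
    RealRMK.integral_rieszMeasure Λ (CompactlySupportedContinuousMap.continuousMapEquiv f)
  refine ⟨⟨RealRMK.rieszMeasure Λ, ?_, inferInstance⟩, hint⟩
  have h1 := hint 1
  simp only [ContinuousMap.one_apply, integral_const, smul_eq_mul, mul_one] at h1
  rw [← ENNReal.ofReal_one, ← ENNReal.ofReal_toReal (measure_ne_top _ Set.univ)]
  exact ENNReal.ofReal_le_ofReal (h1.trans_le hg1)

theorem RadonSubprob.abs_integral_sub_le {X : Type u} [TopologicalSpace X] [CompactSpace X]
    [MeasurableSpace X] [OpensMeasurableSpace X] (μ : RadonSubprob X) (f g : C(X, ℝ)) :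
    |∫ x, f x ∂μ.toMeasure - ∫ x, g x ∂μ.toMeasure| ≤ ‖f - g‖ := by
  have hfin : IsFiniteMeasure μ.toMeasure := ⟨μ.mass_le_one.trans_lt ENNReal.one_lt_top⟩
  have hi : ∀ f : C(X, ℝ), Integrable f μ.toMeasure := fun f =>
    f.continuous.integrable_of_hasCompactSupport (HasCompactSupport.of_compactSpace f)
  rw [← integral_sub (hi f) (hi g), ← Real.norm_eq_abs]
  have h1 : μ.toMeasure.real Set.univ ≤ 1 :=
    ENNReal.toReal_le_of_le_ofReal zero_le_one (by simpa using μ.mass_le_one)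
  refine (norm_integral_le_of_norm_le_const
    (Filter.Eventually.of_forall fun x => (f - g).norm_coe_le_norm x)).trans ?_
  exact mul_le_of_le_one_right (norm_nonneg _) h1

variable {A : Type*} [AddCommGroup A] [Lattice A] [Module ℝ A]
  {X : Type u} [TopologicalSpace X] [CompactSpace X]

/-- M. Riesz extension from the range of `ev`. An injective lattice homomorphism reflects
positivity, so `l` is positive on the range; the range contains the constants, which dominate all of
C(X). -/
theorem exists_posLinear_extension {e : A} (ev : A →ₗ[ℝ] C(X, ℝ))
    (hsup : ∀ a b, ev (a ⊔ b) = ev a ⊔ ev b) (hone : ev e = 1) (hinj : Function.Injective ev)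
    (l : A →ₗ[ℝ] ℝ) (hl : ∀ a, 0 ≤ a → 0 ≤ l a) :
    ∃ g : C(X, ℝ) →ₗ[ℝ] ℝ, (∀ a, g (ev a) = l a) ∧ ∀ f, 0 ≤ f → 0 ≤ g f := by
  let E := LinearEquiv.ofInjective ev hinj
  let f : C(X, ℝ) →ₗ.[ℝ] ℝ := ⟨LinearMap.range ev, l ∘ₗ E.symm.toLinearMap⟩
  have hf : ∀ (a : A) (h : ev a ∈ f.domain), f ⟨ev a, h⟩ = l a := fun a h => by
    change l (E.symm ⟨ev a, h⟩) = l a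
    congr 1
    exact E.symm_apply_apply a
  have nonneg : ∀ x : f.domain, (x : C(X, ℝ)) ∈ PointedCone.positive ℝ C(X, ℝ) → 0 ≤ f x := by
    rintro ⟨_, a, rfl⟩ h
    refine (hl a (sup_eq_left.1 (hinj ?_))).trans_eq (hf a ⟨a, rfl⟩).symm
    rw [hsup, map_zero]
    exact sup_eq_left.2 h
  have dense : ∀ y, ∃ x : f.domain, (x : C(X, ℝ)) + y ∈ PointedCone.positive ℝ C(X, ℝ) := by
    intro y
    refine ⟨⟨ev (‖y‖ • e), _, rfl⟩, ?_⟩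
    change 0 ≤ ev (‖y‖ • e) + y
    intro x
    have h := (abs_le.1 (y.norm_coe_le_norm x)).1
    simp [hone]
    linarith
  obtain ⟨g, hg, hpos⟩ := riesz_extension _ f nonneg dense
  exact ⟨g, fun a => (hg ⟨ev a, a, rfl⟩).trans (hf a _), fun f hf => hpos f hf⟩

variable [IsOrderedAddMonoid A]

/-- Lattice form of Stone–Weierstrass: a sublattice that interpolates arbitrary values at any two
points is dense. -/
theorem denseRange_of_separates {e : A} (ev : A →ₗ[ℝ] C(X, ℝ))
    (hsup : ∀ a b, ev (a ⊔ b) = ev a ⊔ ev b) (hone : ev e = 1)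
    (hsep : ∀ x y, x ≠ y → ∃ a, ev a x ≠ ev a y) : DenseRange ev := by
  have hinf : ∀ a b, ev (a ⊓ b) = ev a ⊓ ev b := fun a b => by
    have h1 : a ⊓ b = a + b - a ⊔ b := eq_sub_of_add_eq (inf_add_sup a b)
    have h2 : ev a ⊓ ev b = ev a + ev b - ev a ⊔ ev b := eq_sub_of_add_eq (inf_add_sup _ _)
    rw [h1, h2, map_sub, map_add, hsup]
  have h := ContinuousMap.sublattice_closure_eq_top (Set.range ev) ⟨_, 0, rfl⟩
    (by rintro _ ⟨a, rfl⟩ _ ⟨b, rfl⟩; exact ⟨_, hinf a b⟩)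
    (by rintro _ ⟨a, rfl⟩ _ ⟨b, rfl⟩; exact ⟨_, hsup a b⟩) ?_
  · exact dense_iff_closure_eq.2 h
  · intro v x y
    by_cases hxy : x = y
    · subst hxy
      exact ⟨_, ⟨v x • e, rfl⟩, by simp [hone], by simp [hone]⟩
    · obtain ⟨a, ha⟩ := hsep x y hxy
      have ha' : ev a x - ev a y ≠ 0 := sub_ne_zero.2 ha
      -- The affine function of `a` with value `v x` at `x` and `v y` at `y`.
      refine ⟨_, ⟨((v x - v y) / (ev a x - ev a y)) • (a - ev a y • e) + v y • e, rfl⟩, ?_, ?_⟩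
      · simp [hone, ha']
      · simp [hone]

theorem exists_markov_of_positive [T2Space X] [MeasurableSpace X] [BorelSpace X] {e : A}
    (ev : A →ₗ[ℝ] C(X, ℝ)) (hsup : ∀ a b, ev (a ⊔ b) = ev a ⊔ ev b) (hone : ev e = 1)
    (hinj : Function.Injective ev) (hsep : ∀ x y, x ≠ y → ∃ a, ev a x ≠ ev a y)
    (D : A →ₗ[ℝ] A) (hD : ∀ a, 0 ≤ a → 0 ≤ D a) (hDe : D e ≤ e) :
    ∃ α : C(X, RadonSubprob X), ∀ a, diaC α (ev a) = ev (D a) := by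
  have hmono : ∀ a b, a ≤ b → ∀ x, ev a x ≤ ev b x := fun a b hab x => by
    have h := hsup a b
    rw [sup_eq_right.2 hab] at h
    rw [h]
    exact le_sup_left (a := ev a x)
  have key : ∀ x : X, ∃ μ : RadonSubprob X, ∀ a, ∫ y, ev a y ∂μ.toMeasure = ev (D a) x := by
    intro x
    let l : A →ₗ[ℝ] ℝ :=
      { toFun := fun a => ev (D a) x
        map_add' := fun a b => by simp
        map_smul' := fun r a => by simp }
    obtain ⟨g, hg, hpos⟩ := exists_posLinear_extension ev hsup hone hinj l
      (fun a ha => by simpa [l] using hmono _ _ (hD a ha) x)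
    obtain ⟨μ, hμ⟩ := exists_radonSubprob_of_positive g hpos (by
      rw [← hone, hg]
      simpa [hone, l] using hmono _ _ hDe x)
    exact ⟨μ, fun a => (hμ (ev a)).trans (hg a)⟩
  choose α hα using key
  have hcont : Continuous α := by
    refine continuous_iInf_rng.2 fun f => continuous_induced_rng.2 ?_
    -- Approximating `f` by `ev a` within ε approximates `x ↦ ∫ f dα(x)` within ε by the continuous
    -- function `ev (D a)`, as all masses are at most 1.
    refine continuous_of_uniform_approx_of_continuous fun u hu => ?_
    obtain ⟨ε, hε, hεu⟩ := Metric.mem_uniformity_dist.1 hu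
    obtain ⟨a, ha⟩ := (denseRange_of_separates ev hsup hone hsep).exists_dist_lt f hε
    refine ⟨ev (D a), (ev (D a)).continuous, fun x => hεu ?_⟩
    rw [← hα, Function.comp_apply, Real.dist_eq]
    exact ((α x).abs_integral_sub_le f (ev a)).trans_lt (by rwa [← dist_eq_norm])
  exact ⟨⟨α, hcont⟩, fun a => ContinuousMap.ext fun x => hα x a⟩

end MarkovConstruction

open Form

/-! ### The Lindenbaum algebra -/

section Lindenbaum

instance provableSetoid : Setoid Form := ⟨Provable, .refl, .symm, .trans⟩

/-- Formulas modulo provable equality. -/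
abbrev Lindenbaum : Type := Quotient provableSetoid

namespace Lindenbaum

theorem mk_eq_mk {φ ψ : Form} : (⟦φ⟧ : Lindenbaum) = ⟦ψ⟧ ↔ Provable φ ψ := Quotient.eq

instance : SMul ℝ Lindenbaum :=
  ⟨fun r => Quotient.map (r • ·) fun _ _ => Provable.congr_smul r⟩
instance : Add Lindenbaum :=
  ⟨Quotient.map₂ (· + ·) fun _ _ h _ _ h' => Provable.congr_add h h'⟩
instance : Max Lindenbaum :=
  ⟨Quotient.map₂ (· ⊔ ·) fun _ _ h _ _ h' => Provable.congr_sup h h'⟩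
instance : Min Lindenbaum :=
  ⟨Quotient.map₂ (· ⊓ ·) fun _ _ h _ _ h' => Provable.congr_inf h h'⟩
instance : Zero Lindenbaum := ⟨⟦0⟧⟩
instance : One Lindenbaum := ⟨⟦1⟧⟩
instance : Neg Lindenbaum := ⟨fun a => (-1 : ℝ) • a⟩

theorem sound {φ ψ : Form} (h : ModalRieszEq φ ψ) : (⟦φ⟧ : Lindenbaum) = ⟦ψ⟧ :=
  Quotient.sound (.base h)

theorem add_neg_self (a : Lindenbaum) : a + -a = 0 :=
  Quotient.inductionOn a fun x => sound (.add_neg x)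

theorem add_comm' (a b : Lindenbaum) : a + b = b + a :=
  Quotient.inductionOn₂ a b fun x y => sound (.add_comm x y)

theorem add_zero' (a : Lindenbaum) : a + 0 = a :=
  Quotient.inductionOn a fun x => sound (.add_zero x)

instance : AddCommGroup Lindenbaum where
  add_assoc a b c := Quotient.inductionOn₃ a b c fun x y z => (sound (.add_assoc x y z)).symm
  add_comm := add_comm'
  zero_add a := (add_comm' 0 a).trans (add_zero' a)
  add_zero := add_zero'
  neg_add_cancel a := (add_comm' (-a) a).trans (add_neg_self a)
  nsmul := nsmulRec
  zsmul := zsmulRec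

instance : Module ℝ Lindenbaum := Module.ofMinimalAxioms
  (fun r a b => Quotient.inductionOn₂ a b fun x y => sound (.smul_add r x y))
  (fun r s a => Quotient.inductionOn a fun x => sound (.add_smul r s x))
  (fun r s a => Quotient.inductionOn a fun x => (sound (.smul_smul r s x)).symm)
  (fun a => Quotient.inductionOn a fun x => sound (.one_smul x))

instance : Lattice Lindenbaum := Lattice.mk'
  (fun a b => Quotient.inductionOn₂ a b fun x y => sound (.sup_comm x y))
  (fun a b c => Quotient.inductionOn₃ a b c fun x y z => (sound (.sup_assoc x y z)).symm)
  (fun a b => Quotient.inductionOn₂ a b fun x y => sound (.inf_comm x y))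
  (fun a b c => Quotient.inductionOn₃ a b c fun x y z => (sound (.inf_assoc x y z)).symm)
  (fun a b => Quotient.inductionOn₂ a b fun x y => sound (.sup_inf_self x y))
  (fun a b => Quotient.inductionOn₂ a b fun x y => sound (.inf_sup_self x y))

theorem mk_le_mk_iff {φ ψ : Form} : (⟦φ⟧ : Lindenbaum) ≤ ⟦ψ⟧ ↔ Provable (φ ⊓ ψ) φ :=
  inf_eq_left.symm.trans mk_eq_mk

instance : IsOrderedAddMonoid Lindenbaum where
  add_le_add_left a b hab c := by
    -- The axiom is an equation with `x ⊓ y` in place of a hypothesis `x ≤ y`, so `a` is first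
    -- written as `a ⊓ b`.
    rw [← inf_eq_left.2 hab]
    induction a, b using Quotient.inductionOn₂ with
    | _ x y =>
      induction c using Quotient.inductionOn with
      | _ z => exact mk_le_mk_iff.2 (.base (.add_compat x y z))

instance : PosSMulMono ℝ Lindenbaum where
  smul_le_smul_of_nonneg_left r hr a b hab := by
    rw [← inf_eq_left.2 hab]
    induction a, b using Quotient.inductionOn₂ with
    | _ x y => exact mk_le_mk_iff.2 (.base (.smul_compat r hr x y))

/-- The operator induced by the modality. -/
def diaLin : Lindenbaum →ₗ[ℝ] Lindenbaum :=
  have h (r s : ℝ) (a b : Lindenbaum) :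
      Quotient.map dia (fun _ _ => Provable.congr_dia) (r • a + s • b) =
        r • (Quotient.map dia (fun _ _ => Provable.congr_dia) a : Lindenbaum) +
          s • (Quotient.map dia (fun _ _ => Provable.congr_dia) b : Lindenbaum) :=
    Quotient.inductionOn₂ a b fun x y => sound (.dia_linear r s x y)
  { toFun := Quotient.map dia fun _ _ => Provable.congr_dia
    map_add' := fun a b => by simpa using h 1 1 a b
    map_smul' := fun r a => by simpa using h r 0 a 0 }

theorem diaLin_nonneg (a : Lindenbaum) (ha : 0 ≤ a) : 0 ≤ diaLin a := by
  rw [← sup_eq_left.2 ha]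
  induction a using Quotient.inductionOn with
  | _ x => exact mk_le_mk_iff.2 (.base (.dia_pos x))

theorem diaLin_mono {a b : Lindenbaum} (h : a ≤ b) : diaLin a ≤ diaLin b := by
  rw [← sub_nonneg, ← map_sub]
  exact diaLin_nonneg _ (sub_nonneg.2 h)

theorem diaLin_one_le : diaLin 1 ≤ 1 := mk_le_mk_iff.2 (.base .dia_one_le)

theorem zero_le_one' : (0 : Lindenbaum) ≤ 1 := mk_le_mk_iff.2 (.base .zero_le_one)

theorem smul_one_mono {r s : ℝ} (h : r ≤ s) : r • (1 : Lindenbaum) ≤ s • 1 := by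
  rw [← sub_nonneg, ← sub_smul]
  exact smul_nonneg (sub_nonneg.2 h) zero_le_one'

/-- `1` is a strong unit. -/
theorem exists_bound (a : Lindenbaum) : ∃ r : ℝ, 0 ≤ r ∧ -(r • 1) ≤ a ∧ a ≤ r • 1 := by
  induction a using Quotient.inductionOn with
  | _ φ =>
  induction φ with
  | zero => exact ⟨0, le_rfl, by simp; exact le_rfl, by simp; exact le_rfl⟩
  | one =>
    refine ⟨1, zero_le_one, ?_, by simp; exact le_rfl⟩
    rw [one_smul]
    exact (neg_nonpos.2 zero_le_one').trans zero_le_one'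
  | smul s φ ih =>
    obtain ⟨r, hr, h1, h2⟩ := ih
    refine ⟨|s| * r, by positivity, ?_⟩
    change _ ≤ s • (⟦φ⟧ : Lindenbaum) ∧ s • (⟦φ⟧ : Lindenbaum) ≤ _
    rw [mul_smul]
    rcases le_total 0 s with hs | hs
    · rw [abs_of_nonneg hs, ← smul_neg]
      exact ⟨smul_le_smul_of_nonneg_left h1 hs, smul_le_smul_of_nonneg_left h2 hs⟩
    · have hs' : 0 ≤ -s := by linarith
      have e : s • (⟦φ⟧ : Lindenbaum) = -s • -(⟦φ⟧ : Lindenbaum) := by simp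
      rw [abs_of_nonpos hs, e, ← smul_neg]
      exact ⟨smul_le_smul_of_nonneg_left (neg_le_neg h2) hs',
        smul_le_smul_of_nonneg_left (neg_le.1 h1) hs'⟩
  | add φ ψ ih ih' =>
    obtain ⟨r, hr, h1, h2⟩ := ih
    obtain ⟨s, hs, h3, h4⟩ := ih'
    refine ⟨r + s, add_nonneg hr hs, ?_, ?_⟩
    · rw [add_smul, neg_add]; exact add_le_add h1 h3
    · rw [add_smul]; exact add_le_add h2 h4
  | sup φ ψ ih ih' =>
    obtain ⟨r, hr, h1, h2⟩ := ih
    obtain ⟨s, hs, h3, h4⟩ := ih'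
    have hr' := smul_one_mono (le_max_left r s)
    have hs' := smul_one_mono (le_max_right r s)
    exact ⟨max r s, le_max_of_le_left hr,
      ((neg_le_neg hr').trans h1).trans (le_sup_left (a := (⟦φ⟧ : Lindenbaum)) (b := ⟦ψ⟧)),
      sup_le (a := (⟦φ⟧ : Lindenbaum)) (b := ⟦ψ⟧) (h2.trans hr') (h4.trans hs')⟩
  | inf φ ψ ih ih' =>
    obtain ⟨r, hr, h1, h2⟩ := ih
    obtain ⟨s, hs, h3, h4⟩ := ih'
    have hr' := smul_one_mono (le_max_left r s)
    have hs' := smul_one_mono (le_max_right r s)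
    exact ⟨max r s, le_max_of_le_left hr,
      le_inf (a := (⟦φ⟧ : Lindenbaum)) (b := ⟦ψ⟧) ((neg_le_neg hr').trans h1)
        ((neg_le_neg hs').trans h3),
      (inf_le_left (a := (⟦φ⟧ : Lindenbaum)) (b := ⟦ψ⟧)).trans (h2.trans hr')⟩
  | dia φ ih =>
    obtain ⟨r, hr, h1, h2⟩ := ih
    -- This is why `0 ≤ r` is carried through the induction.
    have h : r • diaLin 1 ≤ r • 1 := smul_le_smul_of_nonneg_left diaLin_one_le hr
    have h1' := diaLin_mono h1
    have h2' := diaLin_mono h2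
    rw [map_neg, map_smul] at h1'
    rw [map_smul] at h2'
    exact ⟨r, hr, (neg_le_neg h).trans h1', h2'.trans h⟩

theorem exists_le_nat_smul_one (a : Lindenbaum) : ∃ n : ℕ, a ≤ (n : ℝ) • 1 := by
  obtain ⟨r, -, -, h⟩ := exists_bound a
  obtain ⟨n, hn⟩ := exists_nat_ge r
  exact ⟨n, h.trans (smul_one_mono hn)⟩

theorem mk_abs (φ : Form) : (⟦φ.abs⟧ : Lindenbaum) = |(⟦φ⟧ : Lindenbaum)| := by
  have h : (⟦φ.abs⟧ : Lindenbaum) = (⟦φ⟧ : Lindenbaum)⁺ + (⟦φ⟧ : Lindenbaum)⁻ := rfl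
  rw [h, posPart_add_negPart]

/-- The one place where completeness uses the infinitary rule. -/
theorem archimedean (a b : Lindenbaum) (ha : 0 ≤ a) (h : ∀ n : ℕ, n • a ≤ b) : a = 0 := by
  induction a, b using Quotient.inductionOn₂ with
  | _ x y =>
  refine Quotient.sound (Provable.archimedean (y := y) fun n _ => mk_le_mk_iff.1 ?_)
  change (n : ℝ) • (⟦x.abs⟧ : Lindenbaum) ≤ ⟦y.abs⟧
  rw [mk_abs, mk_abs, abs_of_nonneg ha, Nat.cast_smul_eq_nsmul]
  exact (h n).trans (le_abs_self _)

end Lindenbaum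

end Lindenbaum

/-! ### The canonical Markov process -/

section Canonical

/-- The states of the canonical process are the real-valued homomorphisms of the Lindenbaum
algebra. -/
def CanonicalState : Type u := ULift.{u} {h : Lindenbaum → ℝ // IsRealHom 1 h}

namespace CanonicalState

instance : TopologicalSpace CanonicalState.{u} :=
  inferInstanceAs (TopologicalSpace (ULift.{u} {h : Lindenbaum → ℝ // IsRealHom 1 h}))

instance : T2Space CanonicalState.{u} :=
  inferInstanceAs (T2Space (ULift.{u} {h : Lindenbaum → ℝ // IsRealHom 1 h}))

end CanonicalState

theorem IsRealHom.mono {A : Type*} [AddCommGroup A] [Lattice A] [Module ℝ A] {e : A} {h : A → ℝ}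
    (hh : IsRealHom e h) {a b : A} (hab : a ≤ b) : h a ≤ h b := by
  rw [← sup_eq_right.2 hab, hh.map_sup]
  exact le_sup_left

/-- Tychonoff: the strong unit confines each value `h a` to a fixed compact interval, and the
homomorphism laws are closed conditions. -/
theorem isCompact_setOf_isRealHom : IsCompact {h : Lindenbaum → ℝ | IsRealHom 1 h} := by
  choose r hr0 hr1 hr2 using Lindenbaum.exists_bound
  refine (isCompact_univ_pi fun a => isCompact_Icc (a := -r a) (b := r a)).of_isClosed_subset
    ?_ fun h hh a _ => ?_
  · have : {h : Lindenbaum → ℝ | IsRealHom 1 h} =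
        ((⋂ x, ⋂ y, {h | h (x + y) = h x + h y}) ∩ (⋂ r : ℝ, ⋂ x, {h | h (r • x) = r * h x})) ∩
          ((⋂ x, ⋂ y, {h | h (x ⊔ y) = h x ⊔ h y}) ∩ {h | h 1 = 1}) := by
      ext h
      simp only [Set.mem_inter_iff, Set.mem_iInter, Set.mem_ofPred_eq]
      exact ⟨fun h => ⟨⟨h.1, h.2⟩, h.3, h.4⟩, fun h => ⟨h.1.1, h.1.2, h.2.1, h.2.2⟩⟩
    rw [this]
    refine ((isClosed_iInter fun x => isClosed_iInter fun y => isClosed_eq ?_ ?_).inter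
      (isClosed_iInter fun r => isClosed_iInter fun x => isClosed_eq ?_ ?_)).inter
      ((isClosed_iInter fun x => isClosed_iInter fun y => isClosed_eq ?_ ?_).inter
        (isClosed_eq ?_ ?_)) <;> fun_prop
  · have h1 := hh.mono (hr1 a)
    have h2 := hh.mono (hr2 a)
    rw [← neg_smul, hh.map_smul, hh.map_unit, mul_one] at h1
    rw [hh.map_smul, hh.map_unit, mul_one] at h2
    exact ⟨h1, h2⟩

instance : CompactSpace CanonicalState.{u} :=
  have : CompactSpace {h : Lindenbaum → ℝ // IsRealHom 1 h} :=
    isCompact_iff_compactSpace.1 isCompact_setOf_isRealHom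
  inferInstanceAs (CompactSpace (ULift.{u} {h : Lindenbaum → ℝ // IsRealHom 1 h}))

/-- Evaluation of elements of the Lindenbaum algebra at states. -/
def canonicalEval : Lindenbaum →ₗ[ℝ] C(CanonicalState.{u}, ℝ) where
  toFun a := ⟨fun x => x.down.1 a,
    (continuous_apply a).comp (continuous_subtype_val.comp continuous_uliftDown)⟩
  map_add' a b := ContinuousMap.ext fun x => x.down.2.map_add a b
  map_smul' r a := ContinuousMap.ext fun x => x.down.2.map_smul r a

theorem canonicalEval_sup (a b : Lindenbaum) :
    canonicalEval.{u} (a ⊔ b) = canonicalEval a ⊔ canonicalEval b :=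
  ContinuousMap.ext fun x => x.down.2.map_sup a b

theorem canonicalEval_one : canonicalEval.{u} 1 = 1 :=
  ContinuousMap.ext fun x => x.down.2.map_unit

theorem canonicalEval_inf (a b : Lindenbaum) :
    canonicalEval.{u} (a ⊓ b) = canonicalEval a ⊓ canonicalEval b := by
  have h1 : a ⊓ b = a + b - a ⊔ b := eq_sub_of_add_eq (inf_add_sup a b)
  rw [h1, map_sub, map_add, canonicalEval_sup]
  exact (eq_sub_of_add_eq (inf_add_sup _ _)).symm

theorem canonicalEval_injective : Function.Injective canonicalEval.{u} := by
  rw [injective_iff_map_eq_zero]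
  intro a ha
  by_contra hne
  obtain ⟨h, hh, h0⟩ := exists_isRealHom_ne_zero Lindenbaum.zero_le_one'
    Lindenbaum.exists_le_nat_smul_one Lindenbaum.archimedean hne
  exact h0 (DFunLike.congr_fun ha (⟨h, hh⟩ : CanonicalState.{u}))

theorem canonicalEval_separates (x y : CanonicalState.{u}) (hxy : x ≠ y) :
    ∃ a, canonicalEval a x ≠ canonicalEval a y := by
  by_contra! h
  exact hxy (ULift.ext _ _ (Subtype.ext (funext h)))

/-- Truth lemma: the connectives other than ◇ are preserved by evaluation, and ◇ by the construction
of the process. -/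
theorem exists_canonical_process [MeasurableSpace CanonicalState.{u}]
    [BorelSpace CanonicalState.{u}] :
    ∃ α : C(CanonicalState.{u}, RadonSubprob CanonicalState.{u}),
      ∀ φ, semC α φ = canonicalEval ⟦φ⟧ := by
  obtain ⟨α, hα⟩ := exists_markov_of_positive canonicalEval.{u} canonicalEval_sup
    canonicalEval_one canonicalEval_injective canonicalEval_separates Lindenbaum.diaLin
    Lindenbaum.diaLin_nonneg Lindenbaum.diaLin_one_le
  refine ⟨α, fun φ => ?_⟩
  induction φ with
  | zero => exact (map_zero canonicalEval).symm
  | one => exact canonicalEval_one.symm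
  | smul r φ ih =>
    rw [semC, ih]
    exact (map_smul canonicalEval r _).symm
  | add φ ψ ih ih' =>
    rw [semC, ih, ih']
    exact (map_add canonicalEval _ _).symm
  | sup φ ψ ih ih' =>
    rw [semC, ih, ih']
    exact (canonicalEval_sup _ _).symm
  | inf φ ψ ih ih' =>
    rw [semC, ih, ih']
    exact (canonicalEval_inf _ _).symm
  | dia φ ih =>
    rw [semC, ih]
    exact hα _

theorem provable_of_semC_eq {φ ψ : Form}
    (h : ∀ (X : Type u) [TopologicalSpace X] [CompactSpace X] [T2Space X]
      [MeasurableSpace X] [BorelSpace X] (α : C(X, RadonSubprob X)), semC α φ = semC α ψ) :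
    Provable φ ψ := by
  let _ : MeasurableSpace CanonicalState.{u} := borel _
  have : BorelSpace CanonicalState.{u} := ⟨rfl⟩
  obtain ⟨α, hα⟩ := exists_canonical_process.{u}
  have := h _ α
  rw [hα, hα] at this
  exact Lindenbaum.mk_eq_mk.1 (canonicalEval_injective this)

end Canonical

/-! ### Soundness -/

section Soundness

/-- A pointwise interpretation of formulas by real functions, the modality being an integral. -/
structure IsPointwiseSem {X : Type u} (S : Form → X → ℝ) (m : X → (X → ℝ) → ℝ) : Prop where
  zero : ∀ x, S .zero x = 0
  one : ∀ x, S .one x = 1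
  smul : ∀ r φ x, S (.smul r φ) x = r * S φ x
  add : ∀ φ ψ x, S (.add φ ψ) x = S φ x + S ψ x
  sup : ∀ φ ψ x, S (.sup φ ψ) x = max (S φ x) (S ψ x)
  inf : ∀ φ ψ x, S (.inf φ ψ) x = min (S φ x) (S ψ x)
  dia : ∀ φ x, S (.dia φ) x = m x (S φ)
  linear : ∀ r s φ ψ x,
    m x (fun y => r * S φ y + s * S ψ y) = r * m x (S φ) + s * m x (S ψ)
  nonneg : ∀ x f, (∀ y, 0 ≤ f y) → 0 ≤ m x f
  mass : ∀ x, m x (fun _ => 1) ≤ 1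

namespace IsPointwiseSem

variable {X : Type u} {S : Form → X → ℝ} {m : X → (X → ℝ) → ℝ}

theorem zero' (h : IsPointwiseSem S m) (x) : S 0 x = 0 := h.zero x
theorem one' (h : IsPointwiseSem S m) (x) : S 1 x = 1 := h.one x
theorem smul' (h : IsPointwiseSem S m) (r : ℝ) (φ : Form) (x) : S (r • φ) x = r * S φ x :=
  h.smul r φ x
theorem add' (h : IsPointwiseSem S m) (φ ψ : Form) (x) : S (φ + ψ) x = S φ x + S ψ x :=
  h.add φ ψ x
theorem sup' (h : IsPointwiseSem S m) (φ ψ : Form) (x) : S (φ ⊔ ψ) x = max (S φ x) (S ψ x) :=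
  h.sup φ ψ x
theorem inf' (h : IsPointwiseSem S m) (φ ψ : Form) (x) : S (φ ⊓ ψ) x = min (S φ x) (S ψ x) :=
  h.inf φ ψ x
theorem neg' (h : IsPointwiseSem S m) (φ : Form) (x) : S (-φ) x = -S φ x :=
  (h.smul (-1) φ x).trans (by ring)

theorem abs' (h : IsPointwiseSem S m) (φ : Form) (x) : S φ.abs x = |S φ x| := by
  rw [Form.abs, h.add', h.sup', h.sup', h.neg', h.zero']
  exact posPart_add_negPart (S φ x)

theorem modalRieszEq (h : IsPointwiseSem S m) {φ ψ : Form} (hφ : ModalRieszEq φ ψ) :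
    ∀ x, S φ x = S ψ x := by
  intro p
  cases hφ with
  | dia_linear r s x y =>
    rw [h.dia, h.add', h.smul', h.smul', h.dia, h.dia, ← h.linear]
    congr 1
    ext y
    rw [h.add', h.smul', h.smul']
  | dia_pos x =>
    rw [h.inf', h.dia, h.zero', min_eq_left]
    exact h.nonneg _ _ fun y => by rw [h.sup', h.zero']; exact le_max_right _ _
  | dia_one_le =>
    rw [h.inf', h.dia, h.one', min_eq_left]
    have : S 1 = fun _ => 1 := funext h.one'
    rw [this]
    exact h.mass p
  | add_compat x y z => simp [h.add', h.inf']
  | smul_compat r hr x y =>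
    simp only [h.smul', h.inf']
    exact min_eq_left (mul_le_mul_of_nonneg_left (min_le_right _ _) hr)
  | zero_le_one => simp [h.zero', h.one', h.inf']
  | sup_assoc x y z => simp only [h.sup', max_assoc]
  | inf_assoc x y z => simp only [h.inf', min_assoc]
  | sup_comm x y => simp only [h.sup', max_comm]
  | inf_comm x y => simp only [h.inf', min_comm]
  | sup_inf_self x y => simp [h.sup', h.inf']
  | inf_sup_self x y => simp [h.sup', h.inf']
  | sup_idem => simp [h.sup']
  | inf_idem => simp [h.inf']
  | _ => simp only [h.add', h.smul', h.zero', h.neg']; ring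

theorem provable (h : IsPointwiseSem S m) {φ ψ : Form} (hφ : Provable φ ψ) :
    S φ = S ψ := by
  induction hφ with
  | base hb => exact funext (h.modalRieszEq hb)
  | refl => rfl
  | symm _ ih => exact ih.symm
  | trans _ _ ih ih' => exact ih.trans ih'
  | congr_smul r _ ih => ext x; rw [h.smul', h.smul', ih]
  | congr_add _ _ ih ih' => ext x; rw [h.add', h.add', ih, ih']
  | congr_sup _ _ ih ih' => ext x; rw [h.sup', h.sup', ih, ih']
  | congr_inf _ _ ih ih' => ext x; rw [h.inf', h.inf', ih, ih']
  | congr_dia _ ih => ext x; rw [h.dia, h.dia, ih]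
  | @archimedean φ ψ _ ih =>
    ext x
    rw [h.zero']
    have hn : ∀ n : ℕ, 1 ≤ n → n * |S φ x| ≤ |S ψ x| := fun n hn => by
      have := congrFun (ih n hn) x
      rwa [h.inf', h.smul', h.abs', h.abs', min_eq_left_iff] at this
    by_contra hne
    have hpos : 0 < |S φ x| := abs_pos.2 hne
    obtain ⟨n, hlt⟩ := exists_nat_gt (|S ψ x| / |S φ x|)
    rw [div_lt_iff₀ hpos] at hlt
    -- Using `n + 1` makes the side condition `1 ≤ n` of the rule immediate.
    have := hn (n + 1) (by omega)
    push_cast at this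
    linarith

end IsPointwiseSem

/-- Integrability, here from continuity on a compact space, matters only for linearity. Positivity
holds for arbitrary `f`, since a non-integrable function has integral 0. -/
theorem isPointwiseSem_semC {X : Type u} [TopologicalSpace X] [CompactSpace X]
    [MeasurableSpace X] [BorelSpace X] (α : C(X, RadonSubprob X)) :
    IsPointwiseSem (fun φ => ⇑(semC α φ)) (fun x f => ∫ y, f y ∂(α x).toMeasure) := by
  have hfin : ∀ x, IsFiniteMeasure (α x).toMeasure :=
    fun x => ⟨(α x).mass_le_one.trans_lt ENNReal.one_lt_top⟩
  have hi : ∀ x (f : C(X, ℝ)), Integrable f (α x).toMeasure := fun x f =>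
    f.continuous.integrable_of_hasCompactSupport (HasCompactSupport.of_compactSpace f)
  refine ⟨fun _ => rfl, fun _ => rfl, fun _ _ _ => rfl, fun _ _ _ => rfl, fun _ _ _ => rfl,
    fun _ _ _ => rfl, fun _ _ => rfl, fun r s φ ψ x => ?_, fun x f hf => integral_nonneg hf,
    fun x => ?_⟩
  · rw [integral_add ((hi x _).const_mul r) ((hi x _).const_mul s), integral_const_mul,
      integral_const_mul]
  · simpa [Measure.real] using ENNReal.toReal_le_of_le_ofReal zero_le_one (by simpa using (α x).mass_le_one)

theorem isPointwiseSem_semM {X : Type u} [MeasurableSpace X] (τ : SubMarkovKernel X) :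
    IsPointwiseSem (fun φ => (semM τ φ).1) (fun x f => ∫ y, f y ∂(τ.toKernel x)) := by
  have hfin : ∀ x, IsFiniteMeasure (τ.toKernel x) :=
    fun x => ⟨(τ.mass_le_one x).trans_lt ENNReal.one_lt_top⟩
  have hi : ∀ x (f : BddMeas X), Integrable f.1 (τ.toKernel x) := fun x f => by
    obtain ⟨C, hC⟩ := f.2.2
    exact Integrable.of_bound f.2.1.aestronglyMeasurable C (Filter.Eventually.of_forall hC)
  refine ⟨fun _ => rfl, fun _ => rfl, fun _ _ _ => rfl, fun _ _ _ => rfl, fun _ _ _ => rfl,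
    fun _ _ _ => rfl, fun _ _ => rfl, fun r s φ ψ x => ?_, fun x f hf => integral_nonneg hf,
    fun x => ?_⟩
  · rw [integral_add ((hi x _).const_mul r) ((hi x _).const_mul s), integral_const_mul,
      integral_const_mul]
  · simpa [Measure.real] using ENNReal.toReal_le_of_le_ofReal zero_le_one (by simpa using τ.mass_le_one x)

end Soundness

end RieszModal

theorem theorem8p3 (c : RieszModal.ModelClass) (φ ψ : RieszModal.Form) :
    RieszModal.Provable φ ψ ↔
      (∀ (X : Type u) [TopologicalSpace X] [CompactSpace X] [T2Space X]
          [MeasurableSpace X] [BorelSpace X] (α : C(X, RieszModal.RadonSubprob X)),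
        RieszModal.semC α φ = RieszModal.semC α ψ) ∧
      (∀ (X : Type u) [MeasurableSpace X] (_ : c.Admits X) (τ : RieszModal.SubMarkovKernel X),
        RieszModal.semM τ φ = RieszModal.semM τ ψ) := by
  refine ⟨fun h => ⟨?_, ?_⟩, fun h => RieszModal.provable_of_semC_eq h.1⟩
  · intro X _ _ _ _ _ α
    exact DFunLike.coe_injective ((RieszModal.isPointwiseSem_semC α).provable h)
  · intro X _ _ τ
    exact Subtype.ext ((RieszModal.isPointwiseSem_semM τ).provable h)
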